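/- There is an absolute constant $C>0$ such that for every positive integer $r$, every integer $n\ge 2$, and every finite simple graph $G$ on $n$ vertices that does not contain the complete graph $K_r$ as a minor, $$\mathrm{us}(G)\;\le\; C\,\bigl(r\sqrt{\log r}\bigr)^3\log n .$$ Here $\log$ is the natural logarithm. The unique-superior chromatic number $\mathrm{us}(G)$ is the minimum $k$ for which $G=(V,E)$ has a unique-superior coloring with $k$ colors, that is, a proper coloring $c:V\to\{1,\dots,k\}$ such that for every simple path $(u,v,w)$ of length two in $G$ with $c(u)=c(w)$ we have $c(v)>c(u)$. A graph $H$ is a minor of $G$ if one can assign to the vertices $x$ of $H$ pairwise disjoint nonempty sets $B_x\subseteq V$, each inducing a connected subgraph of $G$, such that for every edge $xy$ of $H$ some edge of $G$ joins $B_x$ and $B_y$. -/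

import Mathlib

namespace UniqueSuperior

/-- `H` is a minor of `G`: there are nonempty, pairwise disjoint branch sets in `G`, one for each
vertex of `H`, each inducing a connected subgraph of `G`, such that for every edge `x y` of `H`
some edge of `G` joins the branch set of `x` to the branch set of `y`.
(`SimpleGraph.Connected` includes nonemptiness.) -/
def IsMinor {W V : Type*} (H : SimpleGraph W) (G : SimpleGraph V) : Prop :=
  ∃ B : W → Set V,
    (∀ x, (G.induce (B x)).Connected) ∧
    (∀ x y, x ≠ y → Disjoint (B x) (B y)) ∧
    (∀ x y, H.Adj x y → ∃ u ∈ B x, ∃ v ∈ B y, G.Adj u v)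

/-- A unique-superior coloring with `k` colors: a proper coloring such that for every simple path
`(u, v, w)` of length two whose endpoints have the same color, the middle vertex has a larger
color. -/
def IsUSColoring {V : Type*} (G : SimpleGraph V) {k : ℕ} (c : V → Fin k) : Prop :=
  (∀ u v, G.Adj u v → c u ≠ c v) ∧
  (∀ u v w, G.Adj u v → G.Adj v w → u ≠ w → c u = c w → c u < c v)

/-- The unique-superior chromatic number: the least `k` for which `G` has a unique-superior
coloring with `k` colors. For finite graphs the minimum is attained, see
`exists_isUSColoring_usNumber`. -/
noncomputable def usNumber {V : Type*} (G : SimpleGraph V) : ℕ :=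
  sInf {k : ℕ | ∃ c : V → Fin k, IsUSColoring G c}

theorem exists_isUSColoring_usNumber {V : Type*} [Fintype V] (G : SimpleGraph V) :
    ∃ c : V → Fin (usNumber G), IsUSColoring G c := by
  have h : {k : ℕ | ∃ c : V → Fin k, IsUSColoring G c}.Nonempty :=
    ⟨Fintype.card V, Fintype.equivFin V,
      fun u v huv h => huv.ne ((Fintype.equivFin V).injective h),
      fun u v w _ _ huw h => absurd ((Fintype.equivFin V).injective h) huw⟩
  exact Nat.sInf_mem h

end UniqueSuperior

/-! The proof gives the stronger bound `O((r log r)^2 log n)`. It rests on two facts.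

A graph with at least `d n` edges, where `d` is of order `r log r`, has a `K_r` minor
(`isMinor_completeGraph_of_le_numEdges`). In a counterexample minimal under deletions and
contractions, some vertex has at most `2d` neighbors, and these induce a graph of minimum degree at
least `d`. In such a dense graph, connected dominating sets of logarithmic size can be removed `r`
times, and the removed sets form the minor. Hence every minor of a `K_r`-minor-free graph has
average degree below `2d`.

Sparsity then yields the coloring. Repeatedly peeling off the vertices of small degree gives about
`log₂ n` levels, with at most `4d` neighbors of each vertex on its own level or above
(`exists_levels`). A color is a level refined by a second coordinate, so a middle vertex on a higher
level is automatically superior. The second coordinate only has to separate equal-level vertices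
that are adjacent or have a common neighbor on a level not above theirs. This conflict graph is
`O(d²)`-degenerate (`conflictGraph_degenerate`), so `O(d²)` second coordinates suffice. -/

namespace UniqueSuperior

/-! ### Minors and complete minors inside a vertex set. -/

section Minors

variable {U V W : Type*}

theorem reachable_induce_of_connected {G : SimpleGraph V} {s t : Set V} (hst : s ⊆ t)
    (hs : (G.induce s).Connected) {x y : V} (hx : x ∈ s) (hy : y ∈ s) :
    (G.induce t).Reachable ⟨x, hst hx⟩ ⟨y, hst hy⟩ :=
  (hs.preconnected ⟨x, hx⟩ ⟨y, hy⟩).map (SimpleGraph.induceHomOfLE G hst).toHom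

theorem connected_induce_biUnion {G : SimpleGraph V} {H : SimpleGraph W} {B : W → Set V}
    {s : Set W} (hs : (H.induce s).Connected) (hB : ∀ w, (G.induce (B w)).Connected)
    (hadj : ∀ x y, H.Adj x y → ∃ u ∈ B x, ∃ v ∈ B y, G.Adj u v) :
    (G.induce (⋃ w ∈ s, B w)).Connected := by
  have hsub : ∀ w ∈ s, B w ⊆ ⋃ w ∈ s, B w := fun w hw => Set.subset_biUnion_of_mem hw
  have key : ∀ a b : s, (H.induce s).Walk a b → ∀ x (hx : x ∈ B a) y (hy : y ∈ B b),
      (G.induce (⋃ w ∈ s, B w)).Reachable ⟨x, hsub a a.2 hx⟩ ⟨y, hsub b b.2 hy⟩ := by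
    intro a b p
    induction p with
    | nil => exact fun x hx y hy => reachable_induce_of_connected (hsub _ (Subtype.prop _)) (hB _) hx hy
    | @cons a b c hab p ih =>
      intro x hx y hy
      obtain ⟨u, hu, v, hv, huv⟩ := hadj a b hab
      refine (reachable_induce_of_connected (hsub _ a.2) (hB _) hx hu).trans
        (SimpleGraph.Reachable.trans ?_ (ih v hv y hy))
      exact SimpleGraph.Adj.reachable (by simpa using huv)
  obtain ⟨⟨w, hw⟩⟩ := hs.nonempty
  obtain ⟨⟨x, hx⟩⟩ := (hB w).nonempty
  rw [SimpleGraph.connected_iff_exists_forall_reachable]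
  refine ⟨⟨x, hsub w hw hx⟩, ?_⟩
  rintro ⟨y, hy⟩
  obtain ⟨w', hw', hy'⟩ := Set.mem_iUnion₂.1 hy
  obtain ⟨p⟩ := hs.preconnected ⟨w, hw⟩ ⟨w', hw'⟩
  exact key _ _ p x hx y hy'

theorem IsMinor.trans {K : SimpleGraph U} {H : SimpleGraph W} {G : SimpleGraph V}
    (hKH : IsMinor K H) (hHG : IsMinor H G) : IsMinor K G := by
  obtain ⟨A, hA, hAd, hAa⟩ := hKH
  obtain ⟨B, hB, hBd, hBa⟩ := hHG
  refine ⟨fun x => ⋃ w ∈ A x, B w, fun x => connected_induce_biUnion (hA x) hB hBa, ?_, ?_⟩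
  · intro x y hxy
    simp only [Set.disjoint_iUnion_left, Set.disjoint_iUnion_right]
    intro w hw w' hw'
    exact hBd _ _ fun h => Set.disjoint_left.1 (hAd x y hxy) (h ▸ hw') hw
  · intro x y hxy
    obtain ⟨w, hw, w', hw', h⟩ := hAa x y hxy
    obtain ⟨u, hu, v, hv, huv⟩ := hBa w w' h
    exact ⟨u, Set.mem_biUnion hw hu, v, Set.mem_biUnion hw' hv, huv⟩

theorem connected_induce_singleton (G : SimpleGraph V) (v : V) :
    (G.induce ({v} : Set V)).Connected := by
  rw [SimpleGraph.connected_iff_exists_forall_reachable]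
  refine ⟨⟨v, rfl⟩, ?_⟩
  rintro ⟨w, hw⟩
  obtain rfl : w = v := hw
  exact SimpleGraph.Reachable.refl _

theorem isMinor_of_injective_hom {H : SimpleGraph W} {G : SimpleGraph V} (f : W → V)
    (hf : Function.Injective f) (h : ∀ x y, H.Adj x y → G.Adj (f x) (f y)) : IsMinor H G :=
  ⟨fun x => {f x}, fun x => connected_induce_singleton G (f x),
    fun x y hxy => by simpa using fun h => hxy (hf h),
    fun x y hxy => ⟨f x, rfl, f y, rfl, h x y hxy⟩⟩

theorem isMinor_of_le {H G : SimpleGraph V} (h : H ≤ G) : IsMinor H G :=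
  isMinor_of_injective_hom id Function.injective_id fun _ _ hxy => h hxy

theorem isMinor_induce (G : SimpleGraph V) (s : Set V) : IsMinor (G.induce s) G :=
  isMinor_of_injective_hom Subtype.val Subtype.val_injective fun _ _ hxy => by simpa using hxy

/-- A star: a vertex together with some of its neighbors induces a connected subgraph. -/
theorem connected_induce_star {G : SimpleGraph V} {s : Set V} {u : V} (hu : u ∈ s)
    (h : ∀ v ∈ s, v ≠ u → G.Adj u v) : (G.induce s).Connected := by
  rw [SimpleGraph.connected_iff_exists_forall_reachable]
  refine ⟨⟨u, hu⟩, ?_⟩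
  rintro ⟨v, hv⟩
  by_cases hvu : v = u
  · subst hvu; exact SimpleGraph.Reachable.refl _
  · exact SimpleGraph.Adj.reachable (by simpa using h v hv hvu)

/-- The set `S` contains the branch sets of a complete minor of order `k`. -/
def HasCliqueMinorIn (G : SimpleGraph V) (S : Set V) (k : ℕ) : Prop :=
  ∃ B : Fin k → Set V, (∀ i, B i ⊆ S) ∧ (∀ i, (G.induce (B i)).Connected) ∧
    ∀ i j, i ≠ j → Disjoint (B i) (B j) ∧ ∃ u ∈ B i, ∃ v ∈ B j, G.Adj u v

theorem HasCliqueMinorIn.isMinor {G : SimpleGraph V} {S : Set V} {k : ℕ}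
    (h : HasCliqueMinorIn G S k) : IsMinor (SimpleGraph.completeGraph (Fin k)) G := by
  obtain ⟨B, -, h1, h2⟩ := h
  exact ⟨B, h1, fun x y hxy => (h2 x y hxy).1, fun x y hxy => (h2 x y (by simpa using hxy)).2⟩

theorem HasCliqueMinorIn.mono {G : SimpleGraph V} {S T : Set V} {k : ℕ}
    (h : HasCliqueMinorIn G S k) (hST : S ⊆ T) : HasCliqueMinorIn G T k := by
  obtain ⟨B, h0, h1, h2⟩ := h
  exact ⟨B, fun i => (h0 i).trans hST, h1, h2⟩

theorem hasCliqueMinorIn_zero (G : SimpleGraph V) (S : Set V) : HasCliqueMinorIn G S 0 :=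
  ⟨fun _ => ∅, fun i => i.elim0, fun i => i.elim0, fun i => i.elim0⟩

/-- A connected set dominating the rest of `S` touches every branch set found there, so it serves as
one more branch set. -/
theorem HasCliqueMinorIn.succ {G : SimpleGraph V} {S A : Set V} {k : ℕ} (hAS : A ⊆ S)
    (hA : (G.induce A).Connected) (hdom : ∀ v ∈ S \ A, ∃ a ∈ A, G.Adj a v)
    (h : HasCliqueMinorIn G (S \ A) k) : HasCliqueMinorIn G S (k + 1) := by
  obtain ⟨B, h0, h1, h2⟩ := h
  have key : ∀ i, Disjoint A (B i) ∧ ∃ u ∈ A, ∃ v ∈ B i, G.Adj u v := by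
    intro i
    refine ⟨Set.disjoint_left.2 fun x hx hx' => (h0 i hx').2 hx, ?_⟩
    obtain ⟨⟨v, hv⟩⟩ := (h1 i).nonempty
    obtain ⟨a, ha, hav⟩ := hdom v (h0 i hv)
    exact ⟨a, ha, v, hv, hav⟩
  refine ⟨Fin.cons A B, ?_, ?_, ?_⟩
  · intro i
    refine Fin.cases ?_ (fun i => ?_) i
    · simpa using hAS
    · simpa using (h0 i).trans Set.sdiff_subset
  · intro i
    refine Fin.cases ?_ (fun i => ?_) i
    · rw [Fin.cons_zero]; exact hA
    · rw [Fin.cons_succ]; exact h1 i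
  · intro i j
    refine Fin.cases ?_ (fun i => ?_) i <;> refine Fin.cases ?_ (fun j => ?_) j
    · simp
    · intro _
      rw [Fin.cons_zero, Fin.cons_succ]
      exact key j
    · intro _
      rw [Fin.cons_zero, Fin.cons_succ]
      obtain ⟨hd, u, hu, v, hv, huv⟩ := key i
      exact ⟨hd.symm, v, hv, u, hu, huv.symm⟩
    · intro hij
      rw [Fin.cons_succ, Fin.cons_succ]
      exact h2 i j fun h => hij (h ▸ rfl)

end Minors

/-! ### Complete minors in dense graphs. -/

section Dense

open scoped Classical

variable {V : Type*} {G : SimpleGraph V}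

/-- The neighbors of `v` that lie in the finite set `S`. -/
noncomputable def nbrsIn (G : SimpleGraph V) (S : Finset V) (v : V) : Finset V :=
  {w ∈ S | G.Adj v w}

theorem mem_nbrsIn {S : Finset V} {v w : V} : w ∈ nbrsIn G S v ↔ w ∈ S ∧ G.Adj v w := by
  simp [nbrsIn]

theorem nbrsIn_subset (S : Finset V) (v : V) : nbrsIn G S v ⊆ S := Finset.filter_subset _ _

theorem sum_card_nbrsIn_comm (S U : Finset V) :
    ∑ v ∈ S, (nbrsIn G U v).card = ∑ u ∈ U, (nbrsIn G S u).card := by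
  have := Finset.sum_card_bipartiteAbove_eq_sum_card_bipartiteBelow (s := S) (t := U) G.Adj
  simpa [nbrsIn, Finset.bipartiteAbove, Finset.bipartiteBelow, G.adj_comm] using this

theorem card_nbrsIn_le_add (S B : Finset V) (v : V) :
    (nbrsIn G S v).card ≤ (nbrsIn G (S \ B) v).card + B.card := by
  refine (Finset.card_le_card ?_).trans (Finset.card_union_le _ _)
  intro w hw
  rw [mem_nbrsIn] at hw
  by_cases h : w ∈ B <;> simp [mem_nbrsIn, hw, h]

theorem card_nbrsIn_lt {S : Finset V} {v : V} (hv : v ∈ S) : (nbrsIn G S v).card < S.card :=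
  Finset.card_lt_card ⟨nbrsIn_subset S v, fun h => (mem_nbrsIn.1 (h hv)).2.ne rfl⟩

/-- Any two vertices of `S` lie in a connected subset of `S` of size at most four. -/
def IsLocallyLinked (G : SimpleGraph V) (S : Finset V) : Prop :=
  ∀ u ∈ S, ∀ v ∈ S, ∃ P ⊆ S, u ∈ P ∧ v ∈ P ∧ P.card ≤ 4 ∧ (G.induce (P : Set V)).Connected

/-- Double counting of the edges between `S` and `U`: the average over `S` of the number of
neighbors in `U` is at least `|U| / 3`. -/
theorem exists_nbrsIn_large {S U : Finset V} (hS : S.Nonempty) (hU : U ⊆ S)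
    (hdeg : ∀ v ∈ S, S.card ≤ 3 * (nbrsIn G S v).card) :
    ∃ v ∈ S, U.card ≤ 3 * (nbrsIn G U v).card := by
  by_contra! h
  have h1 : ∑ v ∈ S, 3 * (nbrsIn G U v).card < ∑ v ∈ S, U.card :=
    Finset.sum_lt_sum_of_nonempty hS h
  have h2 : ∑ u ∈ U, S.card ≤ ∑ u ∈ U, 3 * (nbrsIn G S u).card :=
    Finset.sum_le_sum fun u hu => hdeg u (hU hu)
  rw [← Finset.mul_sum] at h1 h2
  rw [sum_card_nbrsIn_comm] at h1
  simp only [Finset.sum_const, smul_eq_mul] at h1 h2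
  linarith [mul_comm S.card U.card]

/-- Greedy domination: each round adds a vertex adjacent to a third of the undominated vertices,
together with a linking set of at most four vertices that keeps `B` connected. -/
theorem exists_connected_dominating_aux {S : Finset V} (hS : S.Nonempty)
    (hlink : IsLocallyLinked G S) (hdeg : ∀ v ∈ S, S.card ≤ 3 * (nbrsIn G S v).card) (t : ℕ) :
    ∃ B ⊆ S, (G.induce (B : Set V)).Connected ∧ B.card ≤ 1 + 4 * t ∧
      {u ∈ S | ∀ b ∈ B, ¬ G.Adj b u}.card * 3 ^ t ≤ S.card * 2 ^ t := by
  induction t with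
  | zero =>
    obtain ⟨a, ha⟩ := hS
    refine ⟨{a}, by simpa using ha, ?_, by simp, ?_⟩
    · rw [Finset.coe_singleton]; exact connected_induce_singleton G a
    · simpa using Finset.card_le_card (Finset.filter_subset _ S)
  | succ t ih =>
    obtain ⟨B, hBS, hB, hBc, hBu⟩ := ih
    set U := {u ∈ S | ∀ b ∈ B, ¬ G.Adj b u} with hUdef
    obtain ⟨v, hv, hvU⟩ := exists_nbrsIn_large (U := U) hS (Finset.filter_subset _ S) hdeg
    obtain ⟨⟨a, ha⟩⟩ := hB.nonempty
    have ha' : a ∈ B := by simpa using ha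
    obtain ⟨P, hPS, haP, hvP, hPc, hP⟩ := hlink a (hBS ha') v hv
    refine ⟨B ∪ P, Finset.union_subset hBS hPS, ?_, ?_, ?_⟩
    · rw [Finset.coe_union]
      exact SimpleGraph.induce_union_connected hB.preconnected hP.preconnected
        ⟨a, by simpa using ha', by simpa using haP⟩
    · have := Finset.card_union_le B P
      omega
    · have hsub : {u ∈ S | ∀ b ∈ B ∪ P, ¬ G.Adj b u} ⊆ U \ nbrsIn G U v := by
        intro u hu
        simp only [Finset.mem_filter, Finset.mem_union] at hu
        simp only [Finset.mem_sdiff, mem_nbrsIn, hUdef, Finset.mem_filter]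
        exact ⟨⟨hu.1, fun b hb => hu.2 b (Or.inl hb)⟩, fun h => hu.2 v (Or.inr hvP) h.2⟩
      have h1 := Finset.card_le_card hsub
      rw [Finset.card_sdiff_of_subset (nbrsIn_subset U v)] at h1
      have h2 : {u ∈ S | ∀ b ∈ B ∪ P, ¬ G.Adj b u}.card * 3 ≤ U.card * 2 := by omega
      calc _ = ({u ∈ S | ∀ b ∈ B ∪ P, ¬ G.Adj b u}.card * 3) * 3 ^ t := by ring
        _ ≤ (U.card * 2) * 3 ^ t := Nat.mul_le_mul_right _ h2
        _ = (U.card * 3 ^ t) * 2 := by ring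
        _ ≤ (S.card * 2 ^ t) * 2 := Nat.mul_le_mul_right _ hBu
        _ = _ := by ring

theorem exists_connected_dominating {S : Finset V} {p : ℕ} (hS : S.Nonempty)
    (hp : S.card < 2 ^ p) (hlink : IsLocallyLinked G S)
    (hdeg : ∀ v ∈ S, S.card ≤ 3 * (nbrsIn G S v).card) :
    ∃ B ⊆ S, (G.induce (B : Set V)).Connected ∧ B.card ≤ 1 + 8 * p ∧
      ∀ u ∈ S, ∃ b ∈ B, G.Adj b u := by
  -- After `2 * p` rounds fewer than `2 ^ p * (4 / 9) ^ p < 1` vertices remain undominated.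
  obtain ⟨B, h1, h2, h3, h4⟩ := exists_connected_dominating_aux hS hlink hdeg (2 * p)
  refine ⟨B, h1, h2, by omega, ?_⟩
  by_contra! h
  obtain ⟨u, hu, hub⟩ := h
  have hpos : 1 ≤ {u ∈ S | ∀ b ∈ B, ¬ G.Adj b u}.card :=
    Finset.card_pos.2 ⟨u, by simpa using ⟨hu, hub⟩⟩
  rw [pow_mul, pow_mul] at h4
  have h5 : S.card * 4 ^ p < 8 ^ p := by
    calc S.card * 4 ^ p < 2 ^ p * 4 ^ p := Nat.mul_lt_mul_of_pos_right hp (by positivity)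
      _ = 8 ^ p := by rw [← mul_pow]; norm_num
  have h6 : 8 ^ p ≤ 9 ^ p := Nat.pow_le_pow_left (by norm_num) p
  norm_num at h4
  nlinarith [pow_pos (show 0 < 9 by norm_num) p]

theorem hasCliqueMinorIn_succ_of_dominating {S B : Finset V} {k : ℕ} (hBS : B ⊆ S)
    (hB : (G.induce (B : Set V)).Connected) (hdom : ∀ u ∈ S, ∃ b ∈ B, G.Adj b u)
    (h : HasCliqueMinorIn G ((S \ B : Finset V) : Set V) k) :
    HasCliqueMinorIn G (S : Set V) (k + 1) := by
  refine HasCliqueMinorIn.succ (A := (B : Set V)) (by simpa using hBS) hB ?_ (by simpa using h)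
  intro v hv
  obtain ⟨b, hb, hbv⟩ := hdom v (by simpa using hv.1)
  exact ⟨b, by simpa using hb, hbv⟩

/-- A set in which any two vertices are at distance at most three is locally linked. -/
theorem isLocallyLinked_of {S : Finset V}
    (h : ∀ u ∈ S, ∀ v ∈ S, u ≠ v → ¬ G.Adj u v → (∃ w ∈ S, G.Adj u w ∧ G.Adj w v) ∨
      ∃ w ∈ S, ∃ x ∈ S, G.Adj u w ∧ G.Adj w x ∧ G.Adj x v) : IsLocallyLinked G S := by
  intro u hu v hv
  by_cases huv : u = v
  · subst huv
    exact ⟨{u}, by simpa using hu, by simp, by simp, by simp, by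
      rw [Finset.coe_singleton]; exact connected_induce_singleton G u⟩
  by_cases ha : G.Adj u v
  · refine ⟨{u, v}, by simp [Finset.insert_subset_iff, hu, hv], by simp, by simp,
      Finset.card_le_two.trans (by norm_num), ?_⟩
    rw [Finset.coe_pair]; exact SimpleGraph.induce_pair_connected_of_adj ha
  rcases h u hu v hv huv ha with ⟨w, hw, h1, h2⟩ | ⟨w, hw, x, hx, h1, h2, h3⟩
  · refine ⟨{u, w} ∪ {w, v}, by simp [Finset.insert_subset_iff, hu, hv, hw],
      by simp, by simp, (Finset.card_union_le _ _).trans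
        (add_le_add Finset.card_le_two Finset.card_le_two), ?_⟩
    rw [Finset.coe_union, Finset.coe_pair, Finset.coe_pair]
    exact SimpleGraph.induce_union_connected
      (SimpleGraph.induce_pair_connected_of_adj h1).preconnected
      (SimpleGraph.induce_pair_connected_of_adj h2).preconnected ⟨w, by simp⟩
  · refine ⟨{u, w} ∪ {x, v},
      by simp [Finset.insert_subset_iff, hu, hv, hw, hx],
      by simp, by simp, (Finset.card_union_le _ _).trans
        (add_le_add Finset.card_le_two Finset.card_le_two), ?_⟩
    rw [Finset.coe_union, Finset.coe_pair, Finset.coe_pair]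
    exact SimpleGraph.connected_induce_union
      (SimpleGraph.induce_pair_connected_of_adj h1).preconnected
      (SimpleGraph.induce_pair_connected_of_adj h3).preconnected (by simp) (by simp) h2

theorem exists_common_nbr {S : Finset V} {u v : V} (hu : u ∈ S)
    (ha : ¬ G.Adj u v) (h : S.card ≤ (nbrsIn G S u).card + (nbrsIn G S v).card) :
    ∃ w ∈ S, G.Adj u w ∧ G.Adj w v := by
  by_contra! hn
  have hd : Disjoint (nbrsIn G S u) (nbrsIn G S v) := by
    rw [Finset.disjoint_left]
    intro w hw hw'
    rw [mem_nbrsIn] at hw hw'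
    exact hn w hw.1 hw.2 hw'.2.symm
  have hlt : (nbrsIn G S u ∪ nbrsIn G S v).card < S.card := by
    refine Finset.card_lt_card ⟨Finset.union_subset (nbrsIn_subset _ _) (nbrsIn_subset _ _), ?_⟩
    intro h
    have := h hu
    simp only [Finset.mem_union, mem_nbrsIn, G.irrefl, and_false, false_or] at this
    exact ha this.2.symm
  rw [Finset.card_union_of_disjoint hd] at hlt
  omega

/-- Degrees of at least `|S| / 2` give nonadjacent vertices a common neighbor, so `S` is locally
linked. Removing a dominating set costs at most `1 + 8 * p` in each degree, which the surplus `k *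
(1 + 8 * p)` pays for. -/
theorem hasCliqueMinorIn_of_dense (p k : ℕ) (S : Finset V) (hS : S.Nonempty) (hp : S.card < 2 ^ p)
    (hdeg : ∀ v ∈ S, S.card + k * (1 + 8 * p) ≤ 2 * (nbrsIn G S v).card) :
    HasCliqueMinorIn G (S : Set V) k := by
  induction k generalizing S with
  | zero => exact hasCliqueMinorIn_zero _ _
  | succ k ih =>
    have hlink : IsLocallyLinked G S := by
      refine isLocallyLinked_of fun u hu v hv huv ha => Or.inl ?_
      exact exists_common_nbr hu ha (by have := hdeg u hu; have := hdeg v hv; omega)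
    obtain ⟨B, hBS, hB, hBc, hdom⟩ := exists_connected_dominating hS hp hlink
      (fun v hv => by have := hdeg v hv; omega)
    have hcard : (S \ B).card = S.card - B.card := Finset.card_sdiff_of_subset hBS
    have hle := Finset.card_le_card hBS
    refine hasCliqueMinorIn_succ_of_dominating hBS hB hdom (ih _ ?_ (by omega) ?_)
    · obtain ⟨v, hv⟩ := hS
      have h1 := hdeg v hv
      have h2 := card_nbrsIn_lt (G := G) hv
      rw [add_mul, one_mul] at h1
      rw [← Finset.card_pos]
      omega
    · intro v hv
      have h1 := hdeg v (Finset.sdiff_subset hv)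
      have h2 := card_nbrsIn_le_add (G := G) S B v
      rw [add_mul, one_mul] at h1
      omega

/-- If two vertices of `S` are at distance more than three in `G[S]`, then the closed neighborhood
of one of them is dense. -/
theorem closed_nbhd_dense {S : Finset V} {D N : ℕ} {u v : V} (hu : u ∈ S) (hv : v ∈ S)
    (huv : u ≠ v) (ha : ¬ G.Adj u v) (h2 : ¬ ∃ w ∈ S, G.Adj u w ∧ G.Adj w v)
    (hN : S.card ≤ N) (hdeg : ∀ v ∈ S, D ≤ (nbrsIn G S v).card)
    (h3 : ¬ ∃ w ∈ S, ∃ x ∈ S, G.Adj u w ∧ G.Adj w x ∧ G.Adj x v) :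
    (insert u (nbrsIn G S u)).card + D ≤ N ∧ ∀ t ∈ insert u (nbrsIn G S u),
      3 * D ≤ (nbrsIn G (insert u (nbrsIn G S u)) t).card + N := by
  push Not at h2 h3
  set T := insert u (nbrsIn G S u) with hT
  set T' := insert v (nbrsIn G S v) with hT'
  have hTS : T ⊆ S := Finset.insert_subset hu (nbrsIn_subset _ _)
  have hTS' : T' ⊆ S := Finset.insert_subset hv (nbrsIn_subset _ _)
  have hTc : D + 1 ≤ T.card := by
    rw [hT, Finset.card_insert_of_notMem (by simp [mem_nbrsIn])]
    exact Nat.succ_le_succ (hdeg u hu)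
  have hTc' : D + 1 ≤ T'.card := by
    rw [hT', Finset.card_insert_of_notMem (by simp [mem_nbrsIn])]
    exact Nat.succ_le_succ (hdeg v hv)
  have hdis : Disjoint T T' := by
    rw [Finset.disjoint_left]
    intro x hx hx'
    simp only [hT, hT', Finset.mem_insert, mem_nbrsIn] at hx hx'
    rcases hx with rfl | hx <;> rcases hx' with rfl | hx'
    · exact huv rfl
    · exact ha hx'.2.symm
    · exact ha hx.2
    · exact h2 x hx.1 hx.2 hx'.2.symm
  have hno : ∀ x ∈ T, ∀ y ∈ T', ¬ G.Adj x y := by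
    intro x hx y hy hxy
    simp only [hT, hT', Finset.mem_insert, mem_nbrsIn] at hx hy
    rcases hx with rfl | hx <;> rcases hy with rfl | hy
    · exact ha hxy
    · exact h2 y hy.1 hxy hy.2.symm
    · exact h2 x hx.1 hx.2 hxy
    · exact h3 x hx.1 y hy.1 hx.2 hxy hy.2.symm
  have hun : T.card + T'.card ≤ S.card := by
    rw [← Finset.card_union_of_disjoint hdis]
    exact Finset.card_le_card (Finset.union_subset hTS hTS')
  refine ⟨by omega, fun t ht => ?_⟩
  have hW : ((S \ T) \ T').card = S.card - T.card - T'.card := by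
    rw [Finset.card_sdiff_of_subset, Finset.card_sdiff_of_subset hTS]
    exact Finset.subset_sdiff.2 ⟨hTS', hdis.symm⟩
  -- Neighbors of `t` avoid `T'`, so those outside `T` lie in a set of size at most `N - 2 * D`.
  have hsub : nbrsIn G S t ⊆ nbrsIn G T t ∪ ((S \ T) \ T') := by
    intro x hx
    rw [mem_nbrsIn] at hx
    have := fun hx' => hno t ht x hx' hx.2
    by_cases hxT : x ∈ T
    · simp [mem_nbrsIn, hxT, hx.2]
    · simp only [Finset.mem_union, Finset.mem_sdiff]
      exact Or.inr ⟨⟨hx.1, hxT⟩, this⟩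
  have h1 := (Finset.card_le_card hsub).trans (Finset.card_union_le _ _)
  have := hdeg t (hTS ht)
  omega

/-- As long as `S` is locally linked, dominating sets are peeled off as before. Otherwise two
vertices are far apart and the closed neighborhood `T` of one is dense: `|T| ≤ N - D`, with inner
degrees at least `3 * D - N`. This exceeds `|T| / 2` once `7 * D ≥ 3 * N`, which explains the ratio
`3 / 7`. -/
theorem hasCliqueMinorIn_of_half_dense (p k E N : ℕ) (S : Finset V) (hS : S.Nonempty)
    (hN : S.card ≤ N) (hp : N < 2 ^ p) (hE : 3 * N ≤ 7 * E)
    (hdeg : ∀ v ∈ S, E + k * (1 + 8 * p) ≤ (nbrsIn G S v).card) :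
    HasCliqueMinorIn G (S : Set V) k := by
  induction k generalizing S with
  | zero => exact hasCliqueMinorIn_zero _ _
  | succ k ih =>
    by_cases hlink : IsLocallyLinked G S
    · obtain ⟨B, hBS, hB, hBc, hdom⟩ := exists_connected_dominating hS (hN.trans_lt hp) hlink
        (fun v hv => by have := hdeg v hv; omega)
      have hcard : (S \ B).card = S.card - B.card := Finset.card_sdiff_of_subset hBS
      have hle := Finset.card_le_card hBS
      refine hasCliqueMinorIn_succ_of_dominating hBS hB hdom (ih _ ?_ (by omega) ?_)
      · obtain ⟨v, hv⟩ := hS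
        have h1 := hdeg v hv
        have h2 := card_nbrsIn_lt (G := G) hv
        rw [add_mul, one_mul] at h1
        rw [← Finset.card_pos]
        omega
      · intro v hv
        have h1 := hdeg v (Finset.sdiff_subset hv)
        have h2 := card_nbrsIn_le_add (G := G) S B v
        rw [add_mul, one_mul] at h1
        omega
    · have := mt isLocallyLinked_of hlink
      push Not at this
      obtain ⟨u, hu, v, hv, huv, ha, h2, h3⟩ := this
      obtain ⟨h4, h5⟩ := closed_nbhd_dense hu hv huv ha (by push Not; exact h2) hN hdeg
        (by push Not; exact h3)
      refine (hasCliqueMinorIn_of_dense p (k + 1) (insert u (nbrsIn G S u)) (by simp) (by omega)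
        fun t ht => ?_).mono ?_
      · have := h5 t ht
        omega
      · simpa [Set.insert_subset_iff, hu] using nbrsIn_subset S u

end Dense

/-! ### Edge density forces complete minors. -/

section EdgeBound

open scoped Classical

universe u

/-- The number of edges of a graph. -/
noncomputable def numEdges {V : Type*} (G : SimpleGraph V) : ℕ := G.edgeSet.ncard

theorem numEdges_eq {V : Type*} (G : SimpleGraph V) [Fintype G.edgeSet] :
    numEdges G = G.edgeFinset.card := by
  rw [numEdges, Set.ncard_eq_toFinset_card', SimpleGraph.edgeFinset]

theorem exists_le_numEdges_eq {V : Type*} [Fintype V] (G : SimpleGraph V) {m : ℕ}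
    (h : m ≤ numEdges G) : ∃ H ≤ G, numEdges H = m := by
  obtain ⟨t, ht, hc⟩ := Set.exists_subset_card_eq h
  have hE : (SimpleGraph.fromEdgeSet t).edgeSet = t := by
    rw [SimpleGraph.edgeSet_fromEdgeSet, sdiff_eq_left, Set.disjoint_left]
    exact fun e he => G.not_isDiag_of_mem_edgeSet (ht he)
  refine ⟨SimpleGraph.fromEdgeSet t, ?_, by rw [numEdges, hE, hc]⟩
  rw [← SimpleGraph.edgeSet_subset_edgeSet, hE]
  exact ht

theorem numEdges_induce_compl {V : Type*} [Fintype V] (G : SimpleGraph V) (v : V) :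
    numEdges (G.induce ({v}ᶜ : Set V)) + (nbrsIn G Finset.univ v).card = numEdges G := by
  have h1 := G.card_edgeFinset_induce_compl_singleton v
  have h2 := G.card_edgeFinset_deleteIncidenceSet v
  have h3 := G.degree_le_card_edgeFinset v
  have h4 : G.degree v = (nbrsIn G Finset.univ v).card := by
    rw [← SimpleGraph.card_neighborFinset_eq_degree]
    congr 1
    ext b
    simp [mem_nbrsIn]
  rw [← numEdges_eq] at h1 h2 h3
  rw [← numEdges_eq] at h1 h2
  omega

theorem sum_card_nbrsIn_univ {V : Type*} [Fintype V] (G : SimpleGraph V) :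
    ∑ v, (nbrsIn G Finset.univ v).card = 2 * numEdges G := by
  rw [numEdges_eq, ← G.sum_degrees_eq_twice_card_edges]
  refine Finset.sum_congr rfl fun v _ => ?_
  rw [← SimpleGraph.card_neighborFinset_eq_degree]
  congr 1
  ext b
  simp [mem_nbrsIn]

/-- The contraction of `y` into `x`, as a graph on the vertices different from `y`. -/
def contract {V : Type*} (G : SimpleGraph V) (x y : V) : SimpleGraph ({y}ᶜ : Set V) :=
  (G ⊔ SimpleGraph.fromRel fun a b => a = x ∧ G.Adj y b).induce {y}ᶜ

theorem isMinor_contract {V : Type*} {G : SimpleGraph V} {x y : V} (hxy : G.Adj x y) :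
    IsMinor (contract G x y) G := by
  refine ⟨fun a => if a.1 = x then {x, y} else {a.1}, ?_, ?_, ?_⟩
  · intro a
    beta_reduce
    by_cases h : a.1 = x
    · rw [if_pos h]; exact SimpleGraph.induce_pair_connected_of_adj hxy
    · rw [if_neg h]; exact connected_induce_singleton G _
  · rintro ⟨a, ha⟩ ⟨b, hb⟩ hab
    have ha : a ≠ y := ha
    have hb : b ≠ y := hb
    have hab : a ≠ b := fun h => hab (Subtype.ext h)
    rw [Set.disjoint_left]
    intro z
    dsimp only
    split_ifs with h1 h2 h2 <;> simp only [Set.mem_insert_iff, Set.mem_singleton_iff] <;> grind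
  · rintro ⟨a, ha⟩ ⟨b, hb⟩ hab
    have hmem : ∀ c : ({y}ᶜ : Set V), c.1 ∈ (if c.1 = x then {x, y} else {c.1} : Set V) := by
      intro c
      split_ifs with h <;> simp [h]
    have hab' : G.Adj a b ∨ a ≠ b ∧ (a = x ∧ G.Adj y b ∨ b = x ∧ G.Adj y a) := by
      simpa [contract] using hab
    rcases hab' with h | ⟨-, ⟨rfl, h⟩ | ⟨rfl, h⟩⟩
    · exact ⟨a, hmem ⟨a, ha⟩, b, hmem ⟨b, hb⟩, h⟩
    · exact ⟨y, by simp, b, hmem ⟨b, hb⟩, h⟩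
    · exact ⟨a, hmem ⟨a, ha⟩, y, by simp, h.symm⟩

/-- Contraction loses the edge `xy` and one edge for each common neighbor of `x` and `y`. -/
theorem numEdges_contract {V : Type*} [Fintype V] {G : SimpleGraph V} {x y : V}
    (hxy : G.Adj x y) : numEdges G ≤ numEdges (contract G x y) +
      (nbrsIn G (nbrsIn G Finset.univ x) y).card + 1 := by
  -- The contraction amounts to joining `x` to the neighbors of `y` and then deleting `y`.
  set G2 : SimpleGraph V := G ⊔ SimpleGraph.fromRel fun a b => a = x ∧ G.Adj y b with hG2
  have h1 : numEdges (contract G x y) + (nbrsIn G2 Finset.univ y).card = numEdges G2 :=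
    numEdges_induce_compl G2 y
  have hadj : ∀ a b, G2.Adj a b ↔
      G.Adj a b ∨ a ≠ b ∧ (a = x ∧ G.Adj y b ∨ b = x ∧ G.Adj y a) := by
    intro a b; simp [hG2]
  have h2 : nbrsIn G2 Finset.univ y = nbrsIn G Finset.univ y := by
    ext b
    simp only [hadj, mem_nbrsIn, Finset.mem_univ, true_and,
      G.irrefl, and_false, or_false, hxy.ne', false_and]
  set A : Finset V := (nbrsIn G Finset.univ y \ nbrsIn G Finset.univ x).erase x with hA
  have hAmem : ∀ b, b ∈ A ↔ b ≠ x ∧ G.Adj y b ∧ ¬ G.Adj x b := by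
    intro b; simp [hA, mem_nbrsIn]
  have h3 : (nbrsIn G Finset.univ y).card ≤
      A.card + (nbrsIn G (nbrsIn G Finset.univ x) y).card + 1 := by
    have hs : nbrsIn G Finset.univ y ⊆ insert x (A ∪ nbrsIn G (nbrsIn G Finset.univ x) y) := by
      intro b hb
      simp only [Finset.mem_insert, Finset.mem_union, hAmem, mem_nbrsIn, Finset.mem_univ,
        true_and] at hb ⊢
      tauto
    have h := (Finset.card_le_card hs).trans (Finset.card_insert_le _ _)
    have := Finset.card_union_le A (nbrsIn G (nbrsIn G Finset.univ x) y)
    omega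
  have h4 : numEdges G + A.card ≤ numEdges G2 := by
    rw [numEdges_eq, numEdges_eq]
    have himg : (A.image fun b => s(x, b)).card = A.card :=
      Finset.card_image_of_injective _ fun b c h => Sym2.congr_right.1 h
    rw [← himg, ← Finset.card_union_of_disjoint]
    · refine Finset.card_le_card (Finset.union_subset ?_ ?_)
      · exact SimpleGraph.edgeFinset_subset_edgeFinset.2 le_sup_left
      · intro e he
        obtain ⟨b, hb, rfl⟩ := Finset.mem_image.1 he
        rw [hAmem] at hb
        rw [SimpleGraph.mem_edgeFinset, SimpleGraph.mem_edgeSet, hadj]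
        exact Or.inr ⟨hb.1.symm, Or.inl ⟨rfl, hb.2.1⟩⟩
    · rw [Finset.disjoint_right]
      intro e he
      obtain ⟨b, hb, rfl⟩ := Finset.mem_image.1 he
      rw [hAmem] at hb
      rw [SimpleGraph.mem_edgeFinset, SimpleGraph.mem_edgeSet]
      exact hb.2.2
  rw [h2] at h1
  omega

theorem card_compl_singleton {V : Type*} [Fintype V] (v : V) :
    Fintype.card ({v}ᶜ : Set V) = Fintype.card V - 1 := by
  rw [Fintype.card_compl_set]; simp

theorem isMinor_completeGraph_of_le_numEdges {d r p E : ℕ} (hd : 1 ≤ d) (hp : 2 * d < 2 ^ p)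
    (hE : 3 * (2 * d) ≤ 7 * E) (hEd : E + r * (1 + 8 * p) ≤ d) (n : ℕ) (hn : 1 ≤ n)
    (V : Type u) [Fintype V] (G : SimpleGraph V) (hV : Fintype.card V = n)
    (hG : d * n ≤ numEdges G) :
    IsMinor (SimpleGraph.completeGraph (Fin r)) G := by
  induction n generalizing V with
  | zero => omega
  | succ n ih =>
    -- Trimming to exactly `d * (n + 1)` edges makes the average degree `2 * d`, which later
    -- supplies a vertex of degree at most `2 * d`.
    obtain ⟨H, hHG, hH⟩ := exists_le_numEdges_eq G hG
    refine IsMinor.trans ?_ (isMinor_of_le hHG)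
    clear hG hHG
    have hn1 : 1 ≤ n := by
      by_contra h0
      obtain rfl : n = 0 := by omega
      have := H.card_edgeFinset_le_card_choose_two
      rw [hV, ← numEdges_eq, hH] at this
      simp at this
      omega
    have hcard : ∀ v : V, Fintype.card ({v}ᶜ : Set V) = n := fun v => by
      rw [card_compl_singleton, hV]; rfl
    by_cases hdeg : ∃ v, (nbrsIn H Finset.univ v).card ≤ d
    · obtain ⟨v, hv⟩ := hdeg
      refine IsMinor.trans (ih hn1 _ _ (hcard v) ?_) (isMinor_induce H {v}ᶜ)
      have := numEdges_induce_compl H v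
      rw [hH, mul_add, mul_one] at this
      omega
    by_cases hcod : ∃ x y, H.Adj x y ∧ (nbrsIn H (nbrsIn H Finset.univ x) y).card < d
    · obtain ⟨x, y, hxy, hlt⟩ := hcod
      refine IsMinor.trans (ih hn1 _ _ (hcard y) ?_) (isMinor_contract hxy)
      have := numEdges_contract hxy
      rw [hH, mul_add, mul_one] at this
      omega
    -- No reduction applies: all degrees exceed `d`, and the ends of every edge have at least `d`
    -- common neighbors. Thus each neighborhood induces minimum degree at least `d`.
    push Not at hdeg hcod
    obtain ⟨x, hx⟩ : ∃ x, (nbrsIn H Finset.univ x).card ≤ 2 * d := by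
      by_contra! hgt
      have hne : (Finset.univ : Finset V).Nonempty := by
        rw [← Finset.card_pos, Finset.card_univ, hV]; omega
      have h1 := Finset.sum_lt_sum_of_nonempty hne fun v _ => hgt v
      rw [sum_card_nbrsIn_univ, hH] at h1
      simp only [Finset.sum_const, Finset.card_univ, hV, smul_eq_mul] at h1
      linarith [mul_comm d (n + 1)]
    have hx0 := hdeg x
    refine (hasCliqueMinorIn_of_half_dense p r E (2 * d) (nbrsIn H Finset.univ x)
      (Finset.card_pos.1 (by omega)) hx hp hE fun v hv => ?_).isMinor
    exact hEd.trans (hcod x v (mem_nbrsIn.1 hv).2)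

end EdgeBound

/-! ### Levels, conflicts and the coloring. -/

section Coloring

open scoped Classical

universe u

variable {V : Type u}

theorem sum_card_nbrsIn_eq (H : SimpleGraph V) (S : Finset V) :
    ∑ v ∈ S, (nbrsIn H S v).card = {x ∈ S ×ˢ S | H.Adj x.1 x.2}.card := by
  simp only [nbrsIn, Finset.card_filter, Finset.sum_product]

theorem sum_card_nbrsIn_eq_numEdges (H : SimpleGraph V) (S : Finset V) :
    ∑ v ∈ S, (nbrsIn H S v).card = 2 * numEdges (H.induce (S : Set V)) := by
  rw [← sum_card_nbrsIn_univ, ← Finset.sum_coe_sort S]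
  refine Finset.sum_congr rfl fun v _ => ?_
  rw [← Finset.card_map (Function.Embedding.subtype _)]
  congr 1
  ext w
  simp [mem_nbrsIn, and_comm]

/-- Every minor of `G` with nonempty finite vertex set has average degree less than `2 * d`. -/
def HasSparseMinors (G : SimpleGraph V) (d : ℕ) : Prop :=
  ∀ (W : Type u) [Fintype W] [Nonempty W] (H : SimpleGraph W), IsMinor H G →
    numEdges H < d * Fintype.card W

theorem HasSparseMinors.sum_lt {G : SimpleGraph V} {d : ℕ} (hG : HasSparseMinors G d)
    {H : SimpleGraph V} {S : Finset V} (hS : S.Nonempty)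
    (hH : IsMinor (H.induce (S : Set V)) G) :
    ∑ v ∈ S, (nbrsIn H S v).card < 2 * d * S.card := by
  have : Nonempty (S : Set V) := hS.to_subtype
  have := hG _ _ hH
  simp only [Finset.coe_sort_coe, Fintype.card_coe] at this
  rw [sum_card_nbrsIn_eq_numEdges, mul_assoc]
  simpa using this

/-- Average degree below `2 * d` means that at most half of `S` has degree above `4 * d`. The others
get level `0`, and the recursion on that half raises its levels by one. -/
theorem exists_levels {G : SimpleGraph V} {d : ℕ} (hd : 1 ≤ d) (hG : HasSparseMinors G d)
    (p : ℕ) (S : Finset V) (hS : S.card < 2 ^ p) :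
    ∃ l : V → ℕ, ∀ v ∈ S, l v < p ∧ {w ∈ S | G.Adj v w ∧ l v ≤ l w}.card ≤ 4 * d := by
  induction p generalizing S with
  | zero => exact ⟨fun _ => 0, fun v hv => by simp_all⟩
  | succ p ih =>
    have hhalf : 2 * {v ∈ S | 4 * d < (nbrsIn G S v).card}.card ≤ S.card := by
      rcases S.eq_empty_or_nonempty with rfl | hne
      · simp
      have h1 := hG.sum_lt hne (isMinor_induce G S)
      have h2 : ∑ v ∈ {v ∈ S | 4 * d < (nbrsIn G S v).card}, 4 * d ≤
          ∑ v ∈ S, (nbrsIn G S v).card :=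
        (Finset.sum_le_sum fun v hv => (Finset.mem_filter.1 hv).2.le).trans
          (Finset.sum_le_sum_of_subset (Finset.filter_subset _ _))
      rw [Finset.sum_const, smul_eq_mul] at h2
      nlinarith
    obtain ⟨l, hl⟩ := ih {v ∈ S | 4 * d < (nbrsIn G S v).card} (by rw [pow_succ] at hS; omega)
    refine ⟨fun v => if v ∈ S ∧ 4 * d < (nbrsIn G S v).card then l v + 1 else 0, fun v hv => ?_⟩
    by_cases h : 4 * d < (nbrsIn G S v).card
    · obtain ⟨h1, h2⟩ := hl v (by simp [hv, h])
      simp only [hv, h, true_and, if_true]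
      refine ⟨by omega, le_trans (Finset.card_le_card fun w hw => ?_) h2⟩
      simp only [Finset.mem_filter] at hw ⊢
      split_ifs at hw with h3
      · exact ⟨h3, hw.2.1, by omega⟩
      · omega
    · simp only [h, and_false, if_false]
      refine ⟨by omega, le_trans (Finset.card_le_card fun w hw => ?_) (not_lt.1 h)⟩
      simp only [Finset.mem_filter] at hw
      exact mem_nbrsIn.2 ⟨hw.1, hw.2.1⟩

/-- The result of contracting each vertex `v` of `L` into its neighbor `f v`. -/
def starContraction (G : SimpleGraph V) (L : Finset V) (f : V → V) : SimpleGraph V :=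
  SimpleGraph.fromRel fun a b => ∃ v ∈ L, f v = a ∧ G.Adj v a ∧ G.Adj v b

theorem isMinor_starContraction {G : SimpleGraph V} {S L : Finset V} (hSL : Disjoint S L)
    (f : V → V) :
    IsMinor ((starContraction G L f).induce (S : Set V)) G := by
  rw [Finset.disjoint_left] at hSL
  refine ⟨fun a => insert a.1 {v | v ∈ L ∧ f v = a ∧ G.Adj v a}, ?_, ?_, ?_⟩
  · intro a
    refine connected_induce_star (Set.mem_insert _ _) ?_
    rintro v (rfl | hv) hva
    · exact absurd rfl hva
    · exact hv.2.2.symm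
  · rintro ⟨a, ha⟩ ⟨b, hb⟩ hab
    have hab : a ≠ b := fun h => hab (Subtype.ext h)
    rw [Set.disjoint_left]
    rintro v (rfl | hv) (rfl | hv')
    · exact hab rfl
    · exact hSL ha hv'.1
    · exact hSL hb hv.1
    · exact hab (hv.2.1.symm.trans hv'.2.1)
  · rintro ⟨a, ha⟩ ⟨b, hb⟩ hab
    obtain ⟨-, ⟨v, hv, h1, h2, h3⟩ | ⟨v, hv, h1, h2, h3⟩⟩ :
        a ≠ b ∧ ((∃ v ∈ L, f v = a ∧ G.Adj v a ∧ G.Adj v b) ∨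
          ∃ v ∈ L, f v = b ∧ G.Adj v b ∧ G.Adj v a) := by
      simpa [starContraction] using hab
    · exact ⟨v, Or.inr ⟨hv, h1, h2⟩, b, Or.inl rfl, h3⟩
    · exact ⟨a, Or.inl rfl, v, Or.inr ⟨hv, h1, h2⟩, h3.symm⟩

/-- Two vertices are adjacent if they have a common `G`-neighbor in `L`. -/
def commonNbrGraph (G : SimpleGraph V) (L : Finset V) : SimpleGraph V where
  Adj u w := u ≠ w ∧ ∃ v ∈ L, G.Adj v u ∧ G.Adj v w
  symm := ⟨fun _ _ ⟨h, v, hv, h1, h2⟩ => ⟨h.symm, v, hv, h2, h1⟩⟩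
  loopless := ⟨fun _ h => h.1 rfl⟩

/-- Each adjacent ordered pair is charged to one common neighbor `wit x` in `L`. Contracting every
`v ∈ L` into the neighbor `f v` at which the most of its pairs start turns at least a `1 / D`
fraction of all pairs into edges of a minor of `G`, which is sparse. -/
theorem sum_card_nbrsIn_commonNbrGraph_le {G : SimpleGraph V} {d D : ℕ}
    (hG : HasSparseMinors G d) {S L : Finset V} (hS : S.Nonempty) (hSL : Disjoint S L)
    (hL : ∀ v ∈ L, (nbrsIn G S v).card ≤ D) :
    ∑ u ∈ S, (nbrsIn (commonNbrGraph G L) S u).card ≤ D * (2 * d * S.card) := by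
  rw [sum_card_nbrsIn_eq]
  set P := {x ∈ S ×ˢ S | (commonNbrGraph G L).Adj x.1 x.2} with hP
  have hwit : ∀ x : V × V, ∃ v, x ∈ P → v ∈ L ∧ G.Adj v x.1 ∧ G.Adj v x.2 := by
    intro x
    by_cases hx : x ∈ P
    · obtain ⟨v, hv⟩ := (Finset.mem_filter.1 hx).2.2
      exact ⟨v, fun _ => hv⟩
    · exact ⟨x.1, fun h => absurd h hx⟩
  choose wit hwit using hwit
  have hf : ∀ v, ∃ u, v ∈ L → {x ∈ P | wit x = v}.card ≤
      D * {x ∈ P | wit x = v ∧ x.1 = u}.card := by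
    intro v
    by_cases hv : v ∈ L
    · have hmaps : ∀ x ∈ {x ∈ P | wit x = v}, x.1 ∈ nbrsIn G S v := by
        intro x hx
        obtain ⟨hxP, rfl⟩ := Finset.mem_filter.1 hx
        exact mem_nbrsIn.2
          ⟨(Finset.mem_product.1 (Finset.mem_filter.1 hxP).1).1, (hwit x hxP).2.1⟩
      rcases (nbrsIn G S v).eq_empty_or_nonempty with he | hne
      · refine ⟨v, fun _ => ?_⟩
        have : {x ∈ P | wit x = v} = ∅ := by
          rw [Finset.eq_empty_iff_forall_notMem]
          intro x hx
          have := hmaps x hx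
          rw [he] at this
          simp at this
        simp [this]
      · obtain ⟨u, -, hu⟩ := Finset.exists_max_image (nbrsIn G S v)
          (fun u => {x ∈ P | wit x = v ∧ x.1 = u}.card) hne
        refine ⟨u, fun _ => ?_⟩
        have := Finset.card_le_mul_card_image_of_maps_to hmaps
          {x ∈ P | wit x = v ∧ x.1 = u}.card
          (fun b hb => by rw [Finset.filter_filter]; exact hu b hb)
        rw [mul_comm] at this
        exact this.trans (Nat.mul_le_mul_right _ (hL v hv))
    · exact ⟨v, fun h => absurd h hv⟩
  choose f hf using hf
  have h1 := hG.sum_lt hS (isMinor_starContraction (G := G) hSL f)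
  rw [sum_card_nbrsIn_eq] at h1
  have h2 : P.card = ∑ v ∈ L, {x ∈ P | wit x = v}.card :=
    Finset.card_eq_sum_card_fiberwise fun x hx => (hwit x hx).1
  have h3 : {x ∈ P | x.1 = f (wit x)}.card = ∑ v ∈ L, {x ∈ P | wit x = v ∧ x.1 = f v}.card := by
    rw [Finset.card_eq_sum_card_fiberwise (f := wit) (t := L)
      fun x hx => (hwit x (Finset.mem_filter.1 hx).1).1]
    refine Finset.sum_congr rfl fun v _ => ?_
    rw [Finset.filter_filter]
    congr 1
    ext x
    simp only [Finset.mem_filter]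
    constructor
    · rintro ⟨h, h', rfl⟩; exact ⟨h, rfl, h'⟩
    · rintro ⟨h, rfl, h'⟩; exact ⟨h, h', rfl⟩
  have h4 : {x ∈ P | x.1 = f (wit x)} ⊆ {x ∈ S ×ˢ S | (starContraction G L f).Adj x.1 x.2} := by
    intro x hx
    obtain ⟨hxP, hxf⟩ := Finset.mem_filter.1 hx
    obtain ⟨hxS, hxn, -⟩ := Finset.mem_filter.1 hxP
    rw [Finset.mem_filter, starContraction, SimpleGraph.fromRel_adj]
    exact ⟨hxS, hxn, Or.inl ⟨wit x, (hwit x hxP).1, hxf.symm, (hwit x hxP).2⟩⟩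
  calc P.card = ∑ v ∈ L, {x ∈ P | wit x = v}.card := h2
    _ ≤ ∑ v ∈ L, D * {x ∈ P | wit x = v ∧ x.1 = f v}.card :=
      Finset.sum_le_sum fun v hv => hf v hv
    _ = D * {x ∈ P | x.1 = f (wit x)}.card := by rw [h3, Finset.mul_sum]
    _ ≤ D * (2 * d * S.card) :=
      Nat.mul_le_mul_left _ ((Finset.card_le_card h4).trans h1.le)

theorem exists_coloring_of_degenerate [Fintype V] (H : SimpleGraph V) (K : ℕ)
    (h : ∀ S : Finset V, S.Nonempty → ∃ v ∈ S, (nbrsIn H S v).card ≤ K) :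
    ∃ c : V → Fin (K + 1), ∀ u v, H.Adj u v → c u ≠ c v := by
  suffices ∀ S : Finset V, ∃ c : V → Fin (K + 1), ∀ u ∈ S, ∀ v ∈ S, H.Adj u v → c u ≠ c v by
    obtain ⟨c, hc⟩ := this Finset.univ
    exact ⟨c, fun u v => hc u (Finset.mem_univ _) v (Finset.mem_univ _)⟩
  intro S
  induction S using Finset.strongInduction with
  | H S ih =>
    rcases S.eq_empty_or_nonempty with rfl | hne
    · exact ⟨fun _ => 0, by simp⟩
    obtain ⟨v, hv, hvK⟩ := h S hne
    obtain ⟨c, hc⟩ := ih (S.erase v) (Finset.erase_ssubset hv)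
    obtain ⟨k, -, hk⟩ := Finset.exists_mem_notMem_of_card_lt_card
      (s := (nbrsIn H S v).image c) (t := Finset.univ)
      (by rw [Finset.card_univ, Fintype.card_fin]
          exact (Finset.card_image_le.trans hvK).trans_lt (Nat.lt_succ_self K))
    have hk' : ∀ w ∈ S, H.Adj v w → c w ≠ k := fun w hw hvw hcw =>
      hk (Finset.mem_image.2 ⟨w, mem_nbrsIn.2 ⟨hw, hvw⟩, hcw⟩)
    refine ⟨Function.update c v k, fun x hx y hy hxy => ?_⟩
    by_cases hxv : x = v
    · subst hxv
      rw [Function.update_self, Function.update_of_ne hxy.ne']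
      exact (hk' y hy hxy).symm
    · by_cases hyv : y = v
      · subst hyv
        rw [Function.update_self, Function.update_of_ne hxv]
        exact hk' x hx hxy.symm
      · rw [Function.update_of_ne hxv, Function.update_of_ne hyv]
        exact hc x (by simp [hx, hxv]) y (by simp [hy, hyv]) hxy

/-- Vertices of the same level are in conflict if they are adjacent, or have a common neighbor
whose level is not larger. -/
def conflictGraph (G : SimpleGraph V) (l : V → ℕ) : SimpleGraph V where
  Adj u w := u ≠ w ∧ l u = l w ∧ (G.Adj u w ∨ ∃ v, l v ≤ l u ∧ G.Adj v u ∧ G.Adj v w)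
  symm := ⟨fun _ _ ⟨h, hl, h'⟩ => ⟨h.symm, hl.symm, h'.imp (fun h => h.symm)
    fun ⟨v, hv, h1, h2⟩ => ⟨v, hl ▸ hv, h2, h1⟩⟩⟩
  loopless := ⟨fun _ h => h.1 rfl⟩

/-- Conflicts stay within one level. Those from adjacency number at most `D`, those through a
neighbor on the same level at most `D * D`. Those through lower levels are controlled only on
average, hence degeneracy and not a maximum degree bound. -/
theorem conflictGraph_degenerate [Fintype V] {G : SimpleGraph V} {d D : ℕ}
    (hG : HasSparseMinors G d) {l : V → ℕ}
    (hl : ∀ v, ({w | G.Adj v w ∧ l v ≤ l w} : Finset V).card ≤ D) (S : Finset V) (hS : S.Nonempty) :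
    ∃ u ∈ S, (nbrsIn (conflictGraph G l) S u).card ≤ D + D * D + D * (2 * d) := by
  obtain ⟨u₀, hu₀⟩ := hS
  set T := {u ∈ S | l u = l u₀} with hT
  set L : Finset V := {v | l v < l u₀} with hL
  have hTne : T.Nonempty := ⟨u₀, by simp [hT, hu₀]⟩
  have hTL : Disjoint T L := by
    rw [Finset.disjoint_left]
    intro x hx hx'
    simp only [hT, hL, Finset.mem_filter, Finset.mem_univ, true_and] at hx hx'
    omega
  have hLD : ∀ v ∈ L, (nbrsIn G T v).card ≤ D := by
    intro v hv
    refine le_trans (Finset.card_le_card fun w hw => ?_) (hl v)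
    simp only [hT, hL, mem_nbrsIn, Finset.mem_filter, Finset.mem_univ, true_and] at hv hw ⊢
    exact ⟨hw.2, by omega⟩
  obtain ⟨u, hu, huD⟩ : ∃ u ∈ T, (nbrsIn (commonNbrGraph G L) T u).card ≤ D * (2 * d) := by
    by_contra! hgt
    have h1 := Finset.sum_lt_sum_of_nonempty hTne hgt
    have h2 := sum_card_nbrsIn_commonNbrGraph_le hG hTne hTL hLD
    rw [Finset.sum_const, smul_eq_mul] at h1
    linarith [mul_comm T.card (D * (2 * d)), mul_assoc D (2 * d) T.card]
  obtain ⟨huS, hul⟩ := Finset.mem_filter.1 hu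
  refine ⟨u, huS, ?_⟩
  have hsub : nbrsIn (conflictGraph G l) S u ⊆
      (({w | G.Adj u w ∧ l u ≤ l w} : Finset V) ∪ ({w | G.Adj u w ∧ l u ≤ l w} : Finset V).biUnion
        fun v => {w | G.Adj v w ∧ l v ≤ l w}) ∪ nbrsIn (commonNbrGraph G L) T u := by
    intro w hw
    obtain ⟨hwS, hne, hlw, h⟩ := mem_nbrsIn.1 hw
    simp only [Finset.mem_union, Finset.mem_biUnion, Finset.mem_filter, Finset.mem_univ, true_and,
      mem_nbrsIn]
    rcases h with h | ⟨v, hv, h1, h2⟩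
    · exact Or.inl (Or.inl ⟨h, hlw.le⟩)
    · rcases hv.lt_or_eq with hv | hv
      · exact Or.inr ⟨by simp [hT, hwS, ← hlw, hul], hne, v, by simpa [hL, ← hul] using hv, h1, h2⟩
      · exact Or.inl (Or.inr ⟨v, ⟨h1.symm, hv.ge⟩, h2, by omega⟩)
  refine (Finset.card_le_card hsub).trans ((Finset.card_union_le _ _).trans
    (add_le_add ((Finset.card_union_le _ _).trans (add_le_add (hl u) ?_)) huD))
  exact (Finset.card_biUnion_le_card_mul _ _ D fun v _ => hl v).trans
    (Nat.mul_le_mul_right _ (hl u))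

/-- The level is the leading digit in base `K`. If the ends of a path share a color, a middle vertex
not above their level would put them in conflict, so it lies on a higher level and has a larger
color. -/
theorem usNumber_le_of_levels {G : SimpleGraph V} {p K : ℕ} {l : V → ℕ} (hl : ∀ v, l v < p)
    (c : V → Fin K) (hc : ∀ u v, (conflictGraph G l).Adj u v → c u ≠ c v) :
    usNumber G ≤ p * K := by
  refine Nat.sInf_le ⟨fun v => finProdFinEquiv (⟨l v, hl v⟩, c v), ?_, ?_⟩
  · intro u v huv h
    have h := finProdFinEquiv.injective h
    simp only [Prod.mk.injEq, Fin.mk.injEq] at h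
    exact hc u v ⟨huv.ne, h.1, Or.inl huv⟩ h.2
  · intro u v w huv hvw huw h
    have h := finProdFinEquiv.injective h
    simp only [Prod.mk.injEq, Fin.mk.injEq] at h
    have hlt : l u < l v := by
      by_contra hle
      exact hc u w ⟨huw, h.1, Or.inr ⟨v, not_lt.1 hle, huv.symm, hvw⟩⟩ h.2
    rw [Fin.lt_def]
    simp only [finProdFinEquiv_apply_val]
    have h1 : K * (l u + 1) ≤ K * l v := Nat.mul_le_mul_left _ hlt
    have h2 := (c u).2
    rw [mul_add, mul_one] at h1
    omega

theorem usNumber_le_of_hasSparseMinors [Fintype V] {G : SimpleGraph V} {d p : ℕ} (hd : 1 ≤ d)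
    (hG : HasSparseMinors G d) (hp : Fintype.card V < 2 ^ p) : usNumber G ≤ p * (29 * d ^ 2) := by
  obtain ⟨l, hl⟩ := exists_levels hd hG p Finset.univ hp
  obtain ⟨c, hc⟩ := exists_coloring_of_degenerate (conflictGraph G l) _
    (conflictGraph_degenerate hG fun v => (hl v (Finset.mem_univ v)).2)
  refine (usNumber_le_of_levels (fun v => (hl v (Finset.mem_univ v)).1) c hc).trans
    (Nat.mul_le_mul_left _ ?_)
  -- With `D = 4 * d` the number of colors per level is `24 * d ^ 2 + 4 * d + 1`.
  nlinarith

end Coloring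

/-! ### Choice of parameters and logarithmic estimates. -/

section Main

universe u

theorem hasSparseMinors_of_not_isMinor {V : Type u} {G : SimpleGraph V} {r : ℕ} (hr : 1 ≤ r)
    (hG : ¬ IsMinor (SimpleGraph.completeGraph (Fin r)) G) :
    HasSparseMinors G (1024 * r * (Nat.log 2 r + 1)) := by
  intro W _ _ H hH
  by_contra! hle
  refine hG (IsMinor.trans ?_ hH)
  set L := Nat.log 2 r + 1 with hL
  have hrL : r < 2 ^ L := Nat.lt_pow_succ_log_self (by norm_num) r
  have hL2 : L < 2 ^ L := Nat.lt_two_pow_self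
  clear_value L
  have hbound : 7 * (r * (1 + 8 * (11 + 2 * L))) ≤ 1024 * r * L := by
    -- As `L ≥ 1`, and `7 * 105 = 735 ≤ 1024`, the peeling cost is at most a seventh of `d`, which
    -- is what `3 * (2 * d) ≤ 7 * E` needs.
    have : 1 + 8 * (11 + 2 * L) ≤ 105 * L := by omega
    nlinarith [Nat.mul_le_mul_left r this]
  refine isMinor_completeGraph_of_le_numEdges (p := 11 + 2 * L)
    (E := 1024 * r * L - r * (1 + 8 * (11 + 2 * L))) (by nlinarith) ?_ (by omega) (by omega)
    (Fintype.card W) Fintype.card_pos W H rfl hle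
  calc 2 * (1024 * r * L) = 2048 * (r * L) := by ring
    _ < 2048 * (2 ^ L * 2 ^ L) := by
      have := Nat.mul_lt_mul'' hrL hL2
      omega
    _ = 2 ^ (11 + 2 * L) := by rw [pow_add, two_mul L, pow_add]; norm_num

theorem natLog_two_add_one_le {n : ℕ} (hn : 2 ≤ n) :
    ((Nat.log 2 n + 1 : ℕ) : ℝ) ≤ 3 * Real.log n := by
  have h2 := Real.log_two_gt_d9
  have h1 : ((2 ^ Nat.log 2 n : ℕ) : ℝ) ≤ n :=
    Nat.cast_le.2 (Nat.pow_log_le_self 2 (by omega))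
  have h3 := Real.log_le_log (by positivity) h1
  rw [Nat.cast_pow, Real.log_pow] at h3
  have h4 : Real.log 2 ≤ Real.log n := Real.log_le_log (by norm_num) (by exact_mod_cast hn)
  push_cast at h3 ⊢
  nlinarith [(Nat.cast_nonneg (Nat.log 2 n) : (0 : ℝ) ≤ _)]

theorem isMinor_completeGraph_of_lt_two {V : Type u} [Nonempty V] (G : SimpleGraph V) {r : ℕ}
    (hr : r < 2) : IsMinor (SimpleGraph.completeGraph (Fin r)) G := by
  have : Subsingleton (Fin r) := Fin.subsingleton_iff_le_one.2 (by omega)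
  exact isMinor_of_injective_hom (fun _ => Classical.arbitrary V)
    (Function.injective_of_subsingleton _) fun x y hxy => absurd (Subsingleton.elim x y) hxy.ne

/-- With `s = √(log r)` this is `r² s⁴ ≤ r³ s³`, which holds since `s ≤ r`. -/
theorem sq_mul_log_le {r : ℕ} (hr : 2 ≤ r) :
    ((r : ℝ) * Real.log r) ^ 2 ≤ ((r : ℝ) * Real.sqrt (Real.log r)) ^ 3 := by
  have hr' : (2 : ℝ) ≤ r := by exact_mod_cast hr
  have h0 : 0 ≤ Real.log r := Real.log_nonneg (by linarith)
  set s := Real.sqrt (Real.log r) with hs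
  have hs0 : 0 ≤ s := Real.sqrt_nonneg _
  have hss : s ^ 2 = Real.log r := Real.sq_sqrt h0
  have hsr : s ≤ r := by
    have := Real.log_le_self (by linarith : (0 : ℝ) ≤ r)
    nlinarith
  rw [← hss]
  have : 0 ≤ (r : ℝ) ^ 2 * s ^ 3 := by positivity
  nlinarith

end Main

end UniqueSuperior

theorem mainTheorem2 :
    ∃ C : ℝ, 0 < C ∧
      ∀ (r n : ℕ), 2 ≤ n →
        ∀ (V : Type*) [Fintype V] (G : SimpleGraph V),
          Fintype.card V = n →
          ¬ UniqueSuperior.IsMinor (SimpleGraph.completeGraph (Fin r)) G →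
          (UniqueSuperior.usNumber G : ℝ) ≤
            C * ((r : ℝ) * Real.sqrt (Real.log (r : ℝ))) ^ 3 * Real.log (n : ℝ) := by
  refine ⟨3 * 29 * (1024 * 3) ^ 2, by norm_num, ?_⟩
  intro r n hn V _ G hV hG
  have : Nonempty V := Fintype.card_pos_iff.1 (by omega)
  -- `K_0` and `K_1` are minors of every nonempty graph.
  have hr : 2 ≤ r := not_lt.1 fun h => hG (UniqueSuperior.isMinor_completeGraph_of_lt_two G h)
  have hus := UniqueSuperior.usNumber_le_of_hasSparseMinors (p := Nat.log 2 n + 1) (by nlinarith)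
    (UniqueSuperior.hasSparseMinors_of_not_isMinor (by omega) hG)
    (by rw [hV]; exact Nat.lt_pow_succ_log_self (by norm_num) n)
  have hr' : (0 : ℝ) ≤ r := Nat.cast_nonneg r
  have hlog : 0 ≤ Real.log n := Real.log_natCast_nonneg n
  have hd : ((1024 * r * (Nat.log 2 r + 1) : ℕ) : ℝ) ≤ 1024 * 3 * (r * Real.log r) := by
    rw [Nat.cast_mul, Nat.cast_mul]
    calc (1024 : ℕ) * (r : ℝ) * ((Nat.log 2 r + 1 : ℕ) : ℝ)
        ≤ (1024 : ℕ) * (r : ℝ) * (3 * Real.log r) :=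
          mul_le_mul_of_nonneg_left (UniqueSuperior.natLog_two_add_one_le hr) (by positivity)
      _ = 1024 * 3 * (r * Real.log r) := by push_cast; ring
  calc (UniqueSuperior.usNumber G : ℝ)
      ≤ ((Nat.log 2 n + 1 : ℕ) : ℝ) * (29 * ((1024 * r * (Nat.log 2 r + 1) : ℕ) : ℝ) ^ 2) := by
        exact_mod_cast hus
    _ ≤ (3 * Real.log n) * (29 * (1024 * 3 * (r * Real.log r)) ^ 2) := by
        gcongr
        exact UniqueSuperior.natLog_two_add_one_le hn
    _ = 3 * 29 * (1024 * 3) ^ 2 * (r * Real.log r) ^ 2 * Real.log n := by ring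
    _ ≤ _ := by
        gcongr
        exact UniqueSuperior.sq_mul_log_le hr
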